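/- Let $n\ge 1$, let $W=(w_{ij})$ be an $n\times n$ row-stochastic real matrix, and let $\mathcal G$ be the directed graph on $\mathcal V=\{1,\dots,n\}$ with a link from $j$ to $i$ if and only if $w_{ij}>0$. Assume that $\mathcal G$ is strongly connected. Let $\theta\in(0,1)$ (the common stubbornness of all agents in the Friedkin–Johnsen model with weight matrix $W$) and $\omega\in(0,1)$ (the weight of a link added by an external influencer, agent $0$). For $\mathcal S\subseteq\mathcal V$ put $D_{\mathcal S}=\sum_{j\in\mathcal S}\mathbf e_j\mathbf e_j^\top$, and let $\bar{\mathcal Y}$ be the Markov chain with states $0'$, $1,\dots,n$, $1',\dots,n'$, in which $0',1',\dots,n'$ are absorbing and, for $i,j\in\mathcal V$, the transition probability from $i$ to $0'$ is $\omega(1-\theta)$ if $i\in\mathcal S$ and $0$ otherwise, from $i$ to $j$ it is $\big[(I-\omega D_{\mathcal S})(1-\theta)W\big]_{ij}$, and from $i$ to $i'$ it is $\theta$. Let $\pi_0(\mathcal S)$ be the probability that $\bar{\mathcal Y}$, started from the uniform distribution on $\{0',1,\dots,n\}$, is absorbed in $0'$. For $\vartheta\in[0,1)$ and $i\in\mathcal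 V$ let $$f(i;\vartheta,\omega)=\frac1n\mathbf 1^\top\big(I-(1-\vartheta)(I-\omega\,\mathbf e_i\mathbf e_i^\top)W\big)^{-1}\mathbf 1 .$$ Assume that $f(\cdot\,;0,\omega)$ has a unique minimizer $i_*$ on $\mathcal V$, and that $\theta$ is small enough that $f(i;\theta,\omega)-f(i_*;\theta,\omega)>0$ for all $i\ne i_*$. For $i,j\in\mathcal V$ let $\tau_{ji}=\min\{t>0: Y_t=i\}$, where $(Y_t)_{t\ge0}$ is the Markov chain on $\mathcal V$ with transition matrix $W$ and $Y_0=j$. Then all expectations $\mathbb E[\tau_{ji}]$ are finite, and the problem $$\text{maximize } \pi_0(\mathcal S)\quad\text{over } \mathcal S\subseteq\mathcal V \text{ with } |\mathcal S|\le 1$$ is equivalent to the problem $$\text{minimize}\quad \frac1n\sum_{j\ne i}\mathbb E[\tau_{ji}]+\frac{1-\omega}{\omega}\,\mathbb E[\tau_{ii}]\quad\text{over } i\in\mathcal V,$$ in the sense that a set $\mathcal S$ is a solution of the first problem if and only if $\mathcal S=\{i\}$ for a solution $i$ of the second. -/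

import Mathlib

open MeasureTheory ProbabilityTheory
open scoped ENNReal unitInterval

noncomputable section

namespace SocialPower

/-! ### Finite homogeneous Markov chains -/

/-- Singletons are measurable in a disjoint union of two spaces with measurable singletons. -/
instance instMeasurableSingletonClassSum {α β : Type*} [MeasurableSpace α] [MeasurableSpace β]
    [MeasurableSingletonClass α] [MeasurableSingletonClass β] :
    MeasurableSingletonClass (α ⊕ β) where
  measurableSet_singleton x := by
    rcases x with a | b
    · rw [← Set.image_singleton]
      exact (measurableSet_singleton a).inl_image
    · rw [← Set.image_singleton]
      exact (measurableSet_singleton b).inr_image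

section Chain

variable {α : Type*} [Fintype α] [DecidableEq α]

/-- The `x`-th row of a row-stochastic matrix, as a probability distribution. -/
def rowPMF (T : Matrix.rowStochastic ℝ α) (x : α) : PMF α :=
  PMF.ofFintype (fun y => ENNReal.ofReal (T.1 x y)) (by
    rw [← ENNReal.ofReal_sum_of_nonneg (fun y _ => T.2.1 x y),
      Matrix.sum_row_of_mem_rowStochastic T.2 x, ENNReal.ofReal_one])

variable [MeasurableSpace α] [MeasurableSingletonClass α]

/-- The one-step transition kernel of the chain with transition matrix `T`. -/
def stepKernel (T : Matrix.rowStochastic ℝ α) : Kernel α α :=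
  Kernel.ofFunOfCountable fun x => (rowPMF T x).toMeasure

instance (T : Matrix.rowStochastic ℝ α) : IsMarkovKernel (stepKernel T) where
  isProbabilityMeasure x := by
    change IsProbabilityMeasure (rowPMF T x).toMeasure
    infer_instance

/-- The conditional law of the state at time `t + 1` given the states at times `0, …, t`:
it depends on the state at time `t` only, through the matrix `T`. -/
def historyKernel (T : Matrix.rowStochastic ℝ α) (t : ℕ) :
    Kernel (Finset.Iic t → α) α :=
  (stepKernel T).comap (fun y => y ⟨t, Finset.mem_Iic.2 le_rfl⟩) (by fun_prop)

instance (T : Matrix.rowStochastic ℝ α) (t : ℕ) : IsMarkovKernel (historyKernel T t) := by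
  unfold historyKernel
  infer_instance

/-- The law, on the space of trajectories `ℕ → α`, of the homogeneous Markov chain with
transition matrix `T` and initial distribution `ν`. -/
def chainLaw (T : Matrix.rowStochastic ℝ α) (ν : Measure α) : Measure (ℕ → α) :=
  Kernel.trajMeasure (X := fun _ => α) ν (historyKernel T)

end Chain

/-- `min {t > 0 : y t = x}`, with value `∞` if the trajectory `y` is never in `x` at a
positive time. -/
def hitTime {α : Type*} (x : α) (y : ℕ → α) : ℕ∞ :=
  ⨅ t ∈ {t : ℕ | 0 < t ∧ y t = x}, (t : ℕ∞)

/-! ### The Friedkin–Johnsen model and its augmented Markov chains -/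

section Model

variable {n : ℕ}

/-- The graph of the weight matrix `W` has a link from `i` to `j` iff `0 < W j i`; it is strongly
connected if there is a directed path from every node to every node. -/
def StronglyConnected (W : Matrix.rowStochastic ℝ (Fin n)) : Prop :=
  ∀ i j : Fin n, Relation.ReflTransGen (fun k l => 0 < W.1 l k) i j

/-- The diagonal matrix `Θ` of the stubbornness coefficients. -/
def stubMatrix (θ : Fin n → I) : Matrix (Fin n) (Fin n) ℝ :=
  Matrix.diagonal fun i => (θ i : ℝ)

/-- The indicator vector `∑_{j ∈ S} e_j`. -/
def indVec (S : Finset (Fin n)) : Fin n → ℝ := fun i => if i ∈ S then 1 else 0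

/-- The transition matrix of the augmented Markov chain of the model `(W, Θ)`, with transient
states `1, …, n` (left summand) and absorbing states `1', …, n'` (right summand). -/
def augMatrix (W : Matrix.rowStochastic ℝ (Fin n)) (θ : Fin n → I) :
    Matrix (Fin n ⊕ Fin n) (Fin n ⊕ Fin n) ℝ :=
  Matrix.fromBlocks ((1 - stubMatrix θ) * W.1) (stubMatrix θ) 0 1

/-- `H(S) = (I - ω ∑_{j ∈ S} e_j e_jᵀ) (I - Θ) W`. -/
def HMatrix (W : Matrix.rowStochastic ℝ (Fin n)) (θ : Fin n → I) (ω : I)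
    (S : Finset (Fin n)) : Matrix (Fin n) (Fin n) ℝ :=
  (1 - (ω : ℝ) • Matrix.diagonal (indVec S)) * (1 - stubMatrix θ) * W.1

/-- States of the augmented chain in the presence of the influencer: the absorbing state `0'`,
the transient states `1, …, n`, and the absorbing states `1', …, n'`. -/
abbrev InflState (n : ℕ) : Type := Unit ⊕ (Fin n ⊕ Fin n)

/-- The transition matrix `T(S)` of the augmented Markov chain when the influencer has added
links of weight `ω` to the agents in `S`. -/
def inflMatrix (W : Matrix.rowStochastic ℝ (Fin n)) (θ : Fin n → I) (ω : I)
    (S : Finset (Fin n)) : Matrix (InflState n) (InflState n) ℝ :=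
  Matrix.fromBlocks 1 0
    (Matrix.fromRows
      (Matrix.replicateCol Unit
        ((ω : ℝ) • ((1 - stubMatrix θ).mulVec (indVec S)))) 0)
    (Matrix.fromBlocks (HMatrix W θ ω S) (stubMatrix θ) 0 1)

lemma one_sub_stub_mul_apply (W : Matrix (Fin n) (Fin n) ℝ) (θ : Fin n → I) (i j : Fin n) :
    ((1 - stubMatrix θ) * W) i j = (1 - (θ i : ℝ)) * W i j := by
  simp [stubMatrix, Matrix.diagonal_mul, sub_mul]

lemma HMatrix_apply (W : Matrix.rowStochastic ℝ (Fin n)) (θ : Fin n → I) (ω : I)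
    (S : Finset (Fin n)) (i j : Fin n) :
    HMatrix W θ ω S i j = (1 - (ω : ℝ) * indVec S i) * ((1 - (θ i : ℝ)) * W.1 i j) := by
  rw [HMatrix, Matrix.mul_assoc, Matrix.sub_mul, Matrix.one_mul, Matrix.smul_mul,
    Matrix.sub_apply, Matrix.smul_apply, Matrix.diagonal_mul, one_sub_stub_mul_apply]
  simp only [smul_eq_mul]
  ring

lemma one_sub_stub_mulVec (θ : Fin n → I) (v : Fin n → ℝ) (i : Fin n) :
    (1 - stubMatrix θ).mulVec v i = (1 - (θ i : ℝ)) * v i := by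
  simp [stubMatrix, Matrix.sub_mulVec, Matrix.mulVec_diagonal, sub_mul]

lemma indVec_mem (S : Finset (Fin n)) (i : Fin n) : 0 ≤ indVec S i ∧ indVec S i ≤ 1 := by
  unfold indVec
  split_ifs <;> norm_num

lemma augMatrix_mem (W : Matrix.rowStochastic ℝ (Fin n)) (θ : Fin n → I) :
    augMatrix W θ ∈ Matrix.rowStochastic ℝ (Fin n ⊕ Fin n) := by
  rw [Matrix.mem_rowStochastic_iff_sum]
  refine ⟨?_, ?_⟩
  · rintro (i | i) (j | j)
    · simp only [augMatrix, Matrix.fromBlocks_apply₁₁, one_sub_stub_mul_apply]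
      exact mul_nonneg (sub_nonneg.2 (θ i).2.2) (W.2.1 i j)
    · simp only [augMatrix, Matrix.fromBlocks_apply₁₂, stubMatrix, Matrix.diagonal_apply]
      split_ifs
      · exact (θ i).2.1
      · exact le_rfl
    · simp [augMatrix]
    · simp only [augMatrix, Matrix.fromBlocks_apply₂₂, Matrix.one_apply]
      split_ifs <;> norm_num
  · rintro (i | i)
    · simp only [augMatrix, Fintype.sum_sum_type, Matrix.fromBlocks_apply₁₁,
        Matrix.fromBlocks_apply₁₂, one_sub_stub_mul_apply, ← Finset.mul_sum,
        Matrix.sum_row_of_mem_rowStochastic W.2 i]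
      simp [stubMatrix, Matrix.diagonal_apply]
    · simp [augMatrix, Fintype.sum_sum_type, Matrix.one_apply]

lemma inflMatrix_mem (W : Matrix.rowStochastic ℝ (Fin n)) (θ : Fin n → I) (ω : I)
    (S : Finset (Fin n)) : inflMatrix W θ ω S ∈ Matrix.rowStochastic ℝ (InflState n) := by
  rw [Matrix.mem_rowStochastic_iff_sum]
  refine ⟨?_, ?_⟩
  · rintro (i | i | i) (j | j | j)
    · simp [inflMatrix]
    · simp [inflMatrix]
    · simp [inflMatrix]
    · simp only [inflMatrix, Matrix.fromBlocks_apply₂₁, Matrix.fromRows_apply_inl,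
        Matrix.replicateCol_apply, Pi.smul_apply, smul_eq_mul, one_sub_stub_mulVec]
      exact mul_nonneg ω.2.1 (mul_nonneg (sub_nonneg.2 (θ i).2.2) (indVec_mem S i).1)
    · simp only [inflMatrix, Matrix.fromBlocks_apply₂₂, Matrix.fromBlocks_apply₁₁, HMatrix_apply]
      refine mul_nonneg (sub_nonneg.2 ?_)
        (mul_nonneg (sub_nonneg.2 (θ i).2.2) (W.2.1 i j))
      exact mul_le_one₀ ω.2.2 (indVec_mem S i).1 (indVec_mem S i).2
    · simp only [inflMatrix, Matrix.fromBlocks_apply₂₂, Matrix.fromBlocks_apply₁₂, stubMatrix,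
        Matrix.diagonal_apply]
      split_ifs
      · exact (θ i).2.1
      · exact le_rfl
    · simp [inflMatrix]
    · simp [inflMatrix]
    · simp only [inflMatrix, Matrix.fromBlocks_apply₂₂, Matrix.one_apply]
      split_ifs <;> norm_num
  · rintro (i | i | i)
    · simp [inflMatrix, Fintype.sum_sum_type]
    · simp only [inflMatrix, Fintype.sum_sum_type, Matrix.fromBlocks_apply₂₁,
        Matrix.fromRows_apply_inl, Matrix.replicateCol_apply, Pi.smul_apply, smul_eq_mul,
        one_sub_stub_mulVec, Matrix.fromBlocks_apply₂₂, Matrix.fromBlocks_apply₁₁,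
        Matrix.fromBlocks_apply₁₂, HMatrix_apply, ← Finset.mul_sum,
        Matrix.sum_row_of_mem_rowStochastic W.2 i]
      simp [stubMatrix, Matrix.diagonal_apply]
      ring
    · simp [inflMatrix, Fintype.sum_sum_type, Matrix.one_apply]

/-- The transition matrix of the augmented chain, as a row-stochastic matrix. -/
def augTransition (W : Matrix.rowStochastic ℝ (Fin n)) (θ : Fin n → I) :
    Matrix.rowStochastic ℝ (Fin n ⊕ Fin n) :=
  ⟨augMatrix W θ, augMatrix_mem W θ⟩

/-- The transition matrix of the augmented chain with influencer, as a row-stochastic matrix. -/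
def inflTransition (W : Matrix.rowStochastic ℝ (Fin n)) (θ : Fin n → I) (ω : I)
    (S : Finset (Fin n)) : Matrix.rowStochastic ℝ (InflState n) :=
  ⟨inflMatrix W θ ω S, inflMatrix_mem W θ ω S⟩

/-- The uniform distribution on the `n + 1` states `0', 1, …, n`. -/
def initLaw (n : ℕ) : Measure (InflState n) :=
  ((n : ℝ≥0∞) + 1)⁻¹ •
    (Measure.dirac (Sum.inl ()) + ∑ i : Fin n, Measure.dirac (Sum.inr (Sum.inl i)))

/-- `π₀(S)`: the probability that the augmented chain with influencer, started uniformly on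
`{0', 1, …, n}`, is absorbed in `0'`. -/
def absorbProb (W : Matrix.rowStochastic ℝ (Fin n)) (θ : Fin n → I) (ω : I)
    (S : Finset (Fin n)) : ℝ≥0∞ :=
  chainLaw (inflTransition W θ ω S) (initLaw n) {y | ∃ t, y t = Sum.inl ()}

/-- `S` solves the problem: maximize `π₀(S)` subject to `|S| ≤ K`. -/
def IsOptimalSet (W : Matrix.rowStochastic ℝ (Fin n)) (θ : Fin n → I) (ω : I) (K : ℕ)
    (S : Finset (Fin n)) : Prop :=
  S.card ≤ K ∧ ∀ S' : Finset (Fin n), S'.card ≤ K → absorbProb W θ ω S' ≤ absorbProb W θ ω S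

/-- `f(S; θ, ω) = (1/n) 1ᵀ (I - (1 - θ)(I - ω ∑_{j ∈ S} e_j e_jᵀ) W)⁻¹ 1`. -/
def objF (W : Matrix.rowStochastic ℝ (Fin n)) (S : Finset (Fin n)) (θ ω : ℝ) : ℝ :=
  (1 / (n : ℝ)) *
    ((1 : Fin n → ℝ) ⬝ᵥ
      ((1 - (1 - θ) • ((1 - ω • Matrix.diagonal (indVec S)) * W.1))⁻¹).mulVec 1)

/-- The stubbornness `θ` is small enough for `W` and `ω`: the minimizer `i₀` of `f(·; 0, ω)` is
unique, and it is also the unique minimizer of `f(·; θ, ω)`. -/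
def SmallStubbornness (W : Matrix.rowStochastic ℝ (Fin n)) (θ ω : ℝ) : Prop :=
  ∃ i₀ : Fin n, (∀ j, j ≠ i₀ → objF W {i₀} 0 ω < objF W {j} 0 ω) ∧
    ∀ i, i ≠ i₀ → 0 < objF W {i} θ ω - objF W {i₀} θ ω

/-- `E[τ_ji]`: the expected first positive time at which the augmented chain of the model without
influencer and without stubbornness, started at `j`, is at `i`. -/
def expHitTime (W : Matrix.rowStochastic ℝ (Fin n)) (j i : Fin n) : ℝ≥0∞ :=
  ∫⁻ y, (hitTime (Sum.inl i) y : ℝ≥0∞)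
    ∂(chainLaw (augTransition W fun _ => 0) (Measure.dirac (Sum.inl j)))

/-- The cost `(1/n) ∑_{j ≠ i} E[τ_ji] + ((1 - ω)/ω) E[τ_ii]`. -/
def hitCost (W : Matrix.rowStochastic ℝ (Fin n)) (ω : ℝ) (i : Fin n) : ℝ≥0∞ :=
  (n : ℝ≥0∞)⁻¹ * ∑ j ∈ Finset.univ.erase i, expHitTime W j i +
    ENNReal.ofReal ((1 - ω) / ω) * expHitTime W i i

end Model

end SocialPower

end

/-! Write `A` for `(1 - θ)(I - ω D_S) W`. The probability of not being in `0'` by time `t` obeys `s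
↦ θ·1 + A s`, a contraction with fixed point `θ (1 - A)⁻¹ 1`. Hence `1 - π₀(S)` is `objF W S θ ω`
times a positive factor independent of `S` (`one_sub_absorbProb`), and maximizing `π₀` means
minimizing `objF`. The empty set is strictly worse than any singleton (`objF_singleton_lt_empty`).

At `θ = 0`, `(1 - A)⁻¹ 1` is the mean absorption time of the chain with one influencer link at `i`:
reach `i`, make a geometric number of returns with mean `(1 - ω)/ω`, then take one last step. So
`objF W {i} 0 ω` is one plus the hitting-time cost (`objF_zero_eq`, `hitCost_eq`).

Small stubbornness says that the same agent is the unique minimizer at `0` and at `θ`, so both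
problems have it as their only solution. Invertibility and positivity throughout come from the
minimum principle `IsTransient.nonneg_of_mulVec_le`. -/

noncomputable section

namespace SocialPower

/-! ### Path integrals of a finite Markov chain and first-passage probabilities. -/

section Chain

variable {α : Type*} [Fintype α] [DecidableEq α]

/-- One step of the chain with transition matrix `T`, weighted by `q` at the new state, as an
operator on functions of the state. -/
def weightedStep (T : Matrix.rowStochastic ℝ α) (q : α → ℝ≥0∞) (f : α → ℝ≥0∞) (x : α) : ℝ≥0∞ :=
  ∑ z, ENNReal.ofReal (T.1 x z) * (q z * f z)

variable [MeasurableSpace α] [MeasurableSingletonClass α]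

lemma lintegral_stepKernel (T : Matrix.rowStochastic ℝ α) (f : α → ℝ≥0∞) (x : α) :
    ∫⁻ z, f z ∂(stepKernel T x) = ∑ z, ENNReal.ofReal (T.1 x z) * f z := by
  rw [lintegral_fintype]
  refine Finset.sum_congr rfl fun z _ => ?_
  change f z * (rowPMF T x).toMeasure {z} = _
  rw [PMF.toMeasure_apply_singleton _ _ (measurableSet_singleton z), mul_comm]
  rfl

instance instIsProbabilityMeasureChainLaw (T : Matrix.rowStochastic ℝ α) (ν : Measure α)
    [IsProbabilityMeasure ν] : IsProbabilityMeasure (chainLaw T ν) := by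
  unfold chainLaw
  infer_instance

/-- The Markov property: the state at time `t + 1` is integrated out given the history up to `t`. -/
lemma lintegral_chainLaw_succ (T : Matrix.rowStochastic ℝ α) (ν : Measure α)
    [IsProbabilityMeasure ν] (t : ℕ) (g : (Finset.Iic t → α) → ℝ≥0∞) (f : α → ℝ≥0∞) :
    ∫⁻ y, g (Preorder.frestrictLe (π := fun _ => α) t y) * f (y (t + 1)) ∂(chainLaw T ν) =
      ∫⁻ y, g (Preorder.frestrictLe (π := fun _ => α) t y) *
        ∑ z, ENNReal.ofReal (T.1 (y t) z) * f z ∂(chainLaw T ν) := by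
  have hg : Measurable g := measurable_of_finite g
  have hf : Measurable f := measurable_of_finite f
  have key := Kernel.map_frestrictLe_trajMeasure_compProd_eq_map_trajMeasure
    (X := fun _ => α) (μ₀ := ν) (κ := historyKernel T) (a := t)
  have hF : Measurable fun p : (Finset.Iic t → α) × α => g p.1 * f p.2 := by fun_prop
  have h1 : ∫⁻ y, g (Preorder.frestrictLe (π := fun _ => α) t y) * f (y (t + 1)) ∂(chainLaw T ν) =
      ∫⁻ p, g p.1 * f p.2 ∂((chainLaw T ν).map
        (fun x => (Preorder.frestrictLe (π := fun _ => α) t x, x (t + 1)))) := by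
    rw [lintegral_map hF (by fun_prop)]
  rw [h1]
  unfold chainLaw
  rw [← key, Measure.lintegral_compProd hF, lintegral_map (by fun_prop) (by fun_prop)]
  refine lintegral_congr fun y => ?_
  dsimp only
  rw [lintegral_const_mul _ hf]
  congr 1
  rw [← lintegral_stepKernel]
  rfl

lemma lintegral_chainLaw_zero (T : Matrix.rowStochastic ℝ α) (ν : Measure α)
    [IsProbabilityMeasure ν] (f : α → ℝ≥0∞) :
    ∫⁻ y, f (y 0) ∂(chainLaw T ν) = ∫⁻ x, f x ∂ν := by
  have hf : Measurable f := measurable_of_finite f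
  have hG : Measurable fun y : Finset.Iic 0 → α => f (y ⟨0, Finset.mem_Iic.2 le_rfl⟩) := by fun_prop
  have key : (chainLaw T ν).map (Preorder.frestrictLe (π := fun _ => α) 0) =
      ν.map (MeasurableEquiv.piUnique (fun _ : Finset.Iic 0 => α)).symm := by
    unfold chainLaw Kernel.trajMeasure
    rw [Measure.map_comp _ _ (by fun_prop), Kernel.traj_map_frestrictLe, Kernel.partialTraj_self,
      Measure.id_comp]
  have h1 : ∫⁻ y, f (y 0) ∂(chainLaw T ν) =
      ∫⁻ y, f (y ⟨0, Finset.mem_Iic.2 le_rfl⟩)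
        ∂((chainLaw T ν).map (Preorder.frestrictLe (π := fun _ => α) 0)) := by
    rw [lintegral_map hG (by fun_prop)]
    rfl
  rw [h1, key, lintegral_map hG (by fun_prop)]
  rfl

lemma lintegral_chainLaw_prod (T : Matrix.rowStochastic ℝ α) (ν : Measure α)
    [IsProbabilityMeasure ν] (g q f : α → ℝ≥0∞) (t : ℕ) :
    ∫⁻ y, g (y 0) * (∏ s ∈ Finset.range t, q (y (s + 1))) * f (y t) ∂(chainLaw T ν) =
      ∫⁻ x, g x * (weightedStep T q)^[t] f x ∂ν := by
  induction t generalizing f with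
  | zero =>
    simpa using lintegral_chainLaw_zero T ν fun x => g x * f x
  | succ t ih =>
    -- The last step of the path is absorbed into the terminal function, which is why the induction
    -- leaves `f` general.
    rw [Function.iterate_succ_apply, ← ih]
    have := lintegral_chainLaw_succ T ν t
      (fun y => g (y ⟨0, by simp⟩) *
        (∏ s ∈ (Finset.range t).attach, q (y ⟨s.1 + 1, by
          have := Finset.mem_range.1 s.2
          exact Finset.mem_Iic.2 this⟩))) (fun z => q z * f z)
    simp only [Preorder.frestrictLe_apply] at this
    refine Eq.trans (lintegral_congr fun y => ?_) (this.trans (lintegral_congr fun y => ?_))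
    · rw [Finset.prod_attach (Finset.range t) (fun s => q (y (s + 1))), Finset.prod_range_succ]
      ring
    · rw [Finset.prod_attach (Finset.range t) (fun s => q (y (s + 1)))]
      rfl

/-- The indicator of the complement of `{x}`. -/
def avoidInd (x z : α) : ℝ≥0∞ := if z = x then 0 else 1

/-- The probability that the chain does not visit `x` at the times `1, …, t`, as a function of
the initial state. -/
def avoidProb (T : Matrix.rowStochastic ℝ α) (x : α) (t : ℕ) : α → ℝ≥0∞ :=
  (weightedStep T (avoidInd x))^[t] fun _ => 1

end Chain

lemma avoidProb_zero {α : Type*} [Fintype α] [DecidableEq α]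
    (T : Matrix.rowStochastic ℝ α) (x a : α) : avoidProb T x 0 a = 1 := rfl

lemma avoidProb_succ {α : Type*} [Fintype α] [DecidableEq α]
    (T : Matrix.rowStochastic ℝ α) (x a : α) (t : ℕ) :
    avoidProb T x (t + 1) a =
      ∑ z, ENNReal.ofReal (T.1 a z) * (avoidInd x z * avoidProb T x t z) := by
  rw [avoidProb, Function.iterate_succ_apply']
  rfl

lemma prod_avoidInd {α : Type*} [DecidableEq α] (x : α) (y : ℕ → α) (t : ℕ) :
    ∏ s ∈ Finset.range t, avoidInd x (y (s + 1)) = if ∀ s < t, y (s + 1) ≠ x then 1 else 0 := by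
  classical
  split_ifs with h
  · exact Finset.prod_eq_one fun s hs => if_neg (h s (Finset.mem_range.1 hs))
  · push Not at h
    obtain ⟨s, hs, hx⟩ := h
    exact Finset.prod_eq_zero (Finset.mem_range.2 hs) (if_pos hx)

lemma enat_toENNReal_eq_tsum (e : ℕ∞) :
    (e : ℝ≥0∞) = ∑' t : ℕ, if (t : ℕ∞) < e then 1 else 0 := by
  classical
  induction e using ENat.recTopCoe with
  | top => simp
  | coe k =>
    rw [tsum_eq_sum (s := Finset.range k)]
    · rw [Finset.sum_congr rfl fun t ht => if_pos (by simpa using ht)]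
      simp
    · intro t ht
      simpa using ht

lemma lt_hitTime_iff {α : Type*} (x : α) (y : ℕ → α) (t : ℕ) :
    (t : ℕ∞) < hitTime x y ↔ ∀ s < t, y (s + 1) ≠ x := by
  constructor
  · intro h s hs hx
    have : hitTime x y ≤ ((s + 1 : ℕ) : ℕ∞) := iInf₂_le (s + 1) ⟨Nat.succ_pos s, hx⟩
    have h2 := h.trans_le this
    norm_cast at h2
    omega
  · intro h
    have : ((t + 1 : ℕ) : ℕ∞) ≤ hitTime x y := by
      refine le_iInf₂ fun r hr => ?_
      obtain ⟨hr, hx⟩ := hr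
      obtain ⟨s, rfl⟩ := Nat.exists_eq_succ_of_ne_zero hr.ne'
      norm_cast
      by_contra hlt
      exact h s (by omega) hx
    exact lt_of_lt_of_le (by norm_cast; omega) this

section Avoid

variable {α : Type*} [Fintype α] [DecidableEq α] [MeasurableSpace α] [MeasurableSingletonClass α]

lemma measurable_avoidInd (x : α) : Measurable (avoidInd x) := measurable_of_finite _

/-- Tail-sum formula for the expectation. Time `0` is not tested in `avoidProb`, so `a = x` gives
the mean return time. -/
lemma lintegral_hitTime (T : Matrix.rowStochastic ℝ α) (a x : α) :
    ∫⁻ y, (hitTime x y : ℝ≥0∞) ∂(chainLaw T (Measure.dirac a)) = ∑' t, avoidProb T x t a := by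
  have hm := measurable_avoidInd x
  have h : ∀ y : ℕ → α, (hitTime x y : ℝ≥0∞) =
      ∑' t, ∏ s ∈ Finset.range t, avoidInd x (y (s + 1)) := by
    intro y
    rw [enat_toENNReal_eq_tsum]
    refine tsum_congr fun t => ?_
    rw [prod_avoidInd]
    simp only [lt_hitTime_iff]
  simp_rw [h]
  have hprod : ∀ t, Measurable fun y : ℕ → α =>
      ∏ s ∈ Finset.range t, avoidInd x (y (s + 1)) := fun t =>
    Finset.measurable_prod _ fun s _ => hm.comp (measurable_pi_apply (s + 1))
  rw [lintegral_tsum fun t => (hprod t).aemeasurable]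
  refine tsum_congr fun t => ?_
  have := lintegral_chainLaw_prod T (Measure.dirac a) (fun _ => 1) (avoidInd x) (fun _ => 1) t
  simpa [avoidProb] using this

lemma chainLaw_avoid (T : Matrix.rowStochastic ℝ α) (ν : Measure α) [IsProbabilityMeasure ν]
    (x : α) (t : ℕ) :
    chainLaw T ν {y | ∀ s ≤ t, y s ≠ x} = ∫⁻ a, avoidInd x a * avoidProb T x t a ∂ν := by
  classical
  have := lintegral_chainLaw_prod T ν (avoidInd x) (avoidInd x) (fun _ => 1) t
  rw [avoidProb, ← this]
  have hs : MeasurableSet {y : ℕ → α | ∀ s ≤ t, y s ≠ x} := by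
    have : {y : ℕ → α | ∀ s ≤ t, y s ≠ x} = ⋂ s, ⋂ (_ : s ≤ t), (fun y => y s) ⁻¹' {x}ᶜ := by
      ext y; simp
    rw [this]
    exact MeasurableSet.iInter fun s => MeasurableSet.iInter fun _ =>
      (measurable_pi_apply s) (measurableSet_singleton x).compl
  rw [← lintegral_indicator_one hs]
  refine lintegral_congr fun y => ?_
  -- Here time `0` must be avoided too, hence the extra factor.
  have h2 : avoidInd x (y 0) * ∏ s ∈ Finset.range t, avoidInd x (y (s + 1)) =
      ∏ s ∈ Finset.range (t + 1), avoidInd x (y s) := by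
    rw [Finset.prod_range_succ', mul_comm]
  rw [h2, mul_one, Set.indicator_apply]
  simp only [Set.mem_ofPred_eq, Pi.one_apply]
  split_ifs with h
  · exact (Finset.prod_eq_one fun s hs =>
      if_neg (h s (Nat.lt_succ_iff.1 (Finset.mem_range.1 hs)))).symm
  · push Not at h
    obtain ⟨s, hs, hx⟩ := h
    have h0 : avoidInd x (y s) = 0 := if_pos hx
    exact (Finset.prod_eq_zero (Finset.mem_range.2 (Nat.lt_succ_iff.2 hs)) h0).symm

lemma tendsto_chainLaw_avoid (T : Matrix.rowStochastic ℝ α) (ν : Measure α)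
    [IsProbabilityMeasure ν] (x : α) :
    Filter.Tendsto (fun t => ∫⁻ a, avoidInd x a * avoidProb T x t a ∂ν) Filter.atTop
      (nhds (1 - chainLaw T ν {y | ∃ t, y t = x})) := by
  have hs : MeasurableSet {y : ℕ → α | ∃ t, y t = x} := by
    have : {y : ℕ → α | ∃ t, y t = x} = ⋃ t, (fun y => y t) ⁻¹' {x} := by
      ext y; simp
    rw [this]
    exact MeasurableSet.iUnion fun s => (measurable_pi_apply s) (measurableSet_singleton x)
  rw [← prob_compl_eq_one_sub hs]
  have hEq : {y : ℕ → α | ∃ t, y t = x}ᶜ = ⋂ t : ℕ, {y | ∀ s ≤ t, y s ≠ x} := by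
    ext y
    simp only [Set.mem_compl_iff, Set.mem_ofPred_eq, not_exists, Set.mem_iInter]
    exact ⟨fun h t s _ => h s, fun h t => h t t le_rfl⟩
  simp_rw [← chainLaw_avoid]
  rw [hEq]
  refine tendsto_measure_iInter_atTop (fun t => ?_) ?_ ⟨0, measure_ne_top _ _⟩
  · have : {y : ℕ → α | ∀ s ≤ t, y s ≠ x} = ⋂ s, ⋂ (_ : s ≤ t), (fun y => y s) ⁻¹' {x}ᶜ := by
      ext y; simp
    rw [this]
    exact (MeasurableSet.iInter fun s => MeasurableSet.iInter fun _ =>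
      (measurable_pi_apply s) (measurableSet_singleton x).compl).nullMeasurableSet
  · intro a b hab y hy s hs
    exact hy s (hs.trans hab)

end Avoid

/-! ### Minimum principle and invertibility for transient substochastic matrices. -/

section Substochastic

variable {α : Type*} [Fintype α]

/-- A matrix with nonnegative entries and row sums at most one, such that every state has a path
to a row whose sum is less than one. -/
structure IsTransient (A : Matrix α α ℝ) : Prop where
  nonneg : ∀ i j, 0 ≤ A i j
  sum_le : ∀ i, ∑ j, A i j ≤ 1
  leak : ∀ i, ∃ k, Relation.ReflTransGen (fun a b => 0 < A a b) i k ∧ ∑ j, A k j < 1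

namespace IsTransient

variable {A : Matrix α α ℝ}

/-- Where `x` attains a negative minimum, `A x ≤ x` forces row sum one and the same minimum at every
successor. Following a path to a leaking row gives a contradiction. -/
lemma nonneg_of_mulVec_le (hA : IsTransient A) {x : α → ℝ} (hx : ∀ i, A.mulVec x i ≤ x i) (i : α) :
    0 ≤ x i := by
  obtain ⟨j, -, hj⟩ := Finset.exists_min_image Finset.univ x ⟨i, Finset.mem_univ i⟩
  have hj : ∀ k, x j ≤ x k := fun k => hj k (Finset.mem_univ k)
  by_contra! hi
  have hm : x j < 0 := (hj i).trans_lt hi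
  have hlow : ∀ a, x j * ∑ b, A a b ≤ A.mulVec x a := by
    intro a
    rw [Finset.mul_sum]
    refine Finset.sum_le_sum fun b _ => ?_
    rw [mul_comm]
    exact mul_le_mul_of_nonneg_left (hj b) (hA.nonneg a b)
  obtain ⟨k, hk, hlt⟩ := hA.leak j
  have hk' : x k = x j := by
    clear hlt
    induction hk with
    | refl => rfl
    | @tail b c _ hbc ih =>
      refine le_antisymm ?_ (hj c)
      by_contra! hc
      have h1 : x j * ∑ d, A b d < A.mulVec x b := by
        rw [Finset.mul_sum]
        refine Finset.sum_lt_sum (fun d _ => ?_) ⟨c, Finset.mem_univ c, ?_⟩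
        · rw [mul_comm]
          exact mul_le_mul_of_nonneg_left (hj d) (hA.nonneg b d)
        · rw [mul_comm]
          exact mul_lt_mul_of_pos_left hc hbc
      have h2 := hx b
      have h3 := hA.sum_le b
      nlinarith
  have h1 := hlow k
  have h2 := hx k
  nlinarith

variable [DecidableEq α]

/-- A kernel vector satisfies `A v = v`; the minimum principle applied to `v` and `-v` makes it
zero. -/
lemma isUnit_det_one_sub (hA : IsTransient A) : IsUnit (1 - A).det := by
  rw [isUnit_iff_ne_zero]
  intro h0
  obtain ⟨v, hv, hv0⟩ := Matrix.exists_mulVec_eq_zero_iff.2 h0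
  rw [Matrix.sub_mulVec, Matrix.one_mulVec, sub_eq_zero] at hv0
  refine hv (funext fun i => le_antisymm ?_ ?_)
  · have := hA.nonneg_of_mulVec_le (x := -v) (fun i => by rw [Matrix.mulVec_neg, ← hv0]) i
    simpa using this
  · exact hA.nonneg_of_mulVec_le (fun i => by rw [← hv0]) i

lemma eq_inv_mulVec (hA : IsTransient A) {x b : α → ℝ} (hx : x = b + A.mulVec x) :
    x = ((1 - A)⁻¹).mulVec b := by
  have : (1 - A).mulVec x = b := by
    rw [Matrix.sub_mulVec, Matrix.one_mulVec]
    exact sub_eq_of_eq_add hx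
  rw [← this, Matrix.mulVec_mulVec, Matrix.nonsing_inv_mul _ hA.isUnit_det_one_sub,
    Matrix.one_mulVec]

lemma inv_mulVec_eq (hA : IsTransient A) (b : α → ℝ) :
    ((1 - A)⁻¹).mulVec b = b + A.mulVec (((1 - A)⁻¹).mulVec b) := by
  have : (1 - A).mulVec (((1 - A)⁻¹).mulVec b) = b := by
    rw [Matrix.mulVec_mulVec, Matrix.mul_nonsing_inv _ hA.isUnit_det_one_sub, Matrix.one_mulVec]
  rw [Matrix.sub_mulVec, Matrix.one_mulVec] at this
  exact eq_add_of_sub_eq this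

lemma inv_mulVec_one_nonneg (hA : IsTransient A) (i : α) : 0 ≤ ((1 - A)⁻¹).mulVec 1 i := by
  refine hA.nonneg_of_mulVec_le (fun i => ?_) i
  have := congrFun (hA.inv_mulVec_eq 1) i
  rw [Pi.add_apply, Pi.one_apply] at this
  linarith

end IsTransient

end Substochastic

/-! ### Taboo and influenced matrices; the objective without stubbornness. -/

section Model

variable {n : ℕ}

lemma sum_row (W : Matrix.rowStochastic ℝ (Fin n)) (i : Fin n) : ∑ j, W.1 i j = 1 :=
  Matrix.sum_row_of_mem_rowStochastic W.2 i

/-- `W` with its `i`-th column replaced by zero. -/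
def tabooMatrix (W : Matrix.rowStochastic ℝ (Fin n)) (i : Fin n) : Matrix (Fin n) (Fin n) ℝ :=
  fun a b => if b = i then 0 else W.1 a b

/-- Links of the graph point against the moves of the chain, so paths are reversed. -/
lemma exists_path (W : Matrix.rowStochastic ℝ (Fin n)) (hconn : StronglyConnected W)
    (a b : Fin n) : Relation.ReflTransGen (fun k l => 0 < W.1 k l) a b :=
  (Relation.reflTransGen_swap).1 (hconn b a)

lemma exists_pos (W : Matrix.rowStochastic ℝ (Fin n)) (a : Fin n) : ∃ b, 0 < W.1 a b := by
  by_contra! h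
  have := Finset.sum_nonpos fun b (_ : b ∈ Finset.univ) => h b
  rw [sum_row] at this
  linarith

lemma exists_transGen (W : Matrix.rowStochastic ℝ (Fin n)) (hconn : StronglyConnected W)
    (a b : Fin n) : Relation.TransGen (fun k l => 0 < W.1 k l) a b := by
  obtain ⟨c, hc⟩ := exists_pos W a
  exact Relation.TransGen.head' hc (exists_path W hconn c b)

lemma sum_tabooMatrix (W : Matrix.rowStochastic ℝ (Fin n)) (i a : Fin n) :
    ∑ b, tabooMatrix W i a b = 1 - W.1 a i := by
  have h : ∀ b, tabooMatrix W i a b = W.1 a b - if b = i then W.1 a b else 0 := by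
    intro b
    unfold tabooMatrix
    split_ifs <;> simp
  simp_rw [h]
  rw [Finset.sum_sub_distrib, sum_row]
  simp

lemma isTransient_tabooMatrix (W : Matrix.rowStochastic ℝ (Fin n)) (hconn : StronglyConnected W)
    (i : Fin n) : IsTransient (tabooMatrix W i) where
  nonneg a b := by
    unfold tabooMatrix
    split_ifs
    · exact le_rfl
    · exact W.2.1 a b
  sum_le a := by
    rw [sum_tabooMatrix]
    have := W.2.1 a i
    linarith
  leak a := by
    simp_rw [sum_tabooMatrix]
    -- A path of positive length is needed, since `a` may be `i`. It is cut at its first arrival in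
    -- `i`: the state just before has a leaking row.
    have h := exists_transGen W hconn a i
    induction h using Relation.TransGen.head_induction_on with
    | @single a h => exact ⟨a, .refl, by linarith⟩
    | @head a c hac _ ih =>
      by_cases hc : c = i
      · subst hc
        exact ⟨a, .refl, by linarith⟩
      · obtain ⟨k, hk, hlt⟩ := ih
        refine ⟨k, .head ?_ hk, hlt⟩
        simpa [tabooMatrix, hc] using hac

/-- The matrix `(1 - θ) (I - ω ∑_{j ∈ S} e_j e_jᵀ) W`. -/
def objMatrix (W : Matrix.rowStochastic ℝ (Fin n)) (S : Finset (Fin n)) (θ ω : ℝ) :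
    Matrix (Fin n) (Fin n) ℝ :=
  (1 - θ) • ((1 - ω • Matrix.diagonal (indVec S)) * W.1)

lemma objMatrix_apply (W : Matrix.rowStochastic ℝ (Fin n)) (S : Finset (Fin n)) (θ ω : ℝ)
    (a b : Fin n) : objMatrix W S θ ω a b = (1 - θ) * ((1 - ω * indVec S a) * W.1 a b) := by
  rw [objMatrix, Matrix.sub_mul, Matrix.one_mul, Matrix.smul_mul, Matrix.smul_apply,
    Matrix.sub_apply, Matrix.smul_apply, Matrix.diagonal_mul]
  simp only [smul_eq_mul]
  ring

lemma sum_objMatrix (W : Matrix.rowStochastic ℝ (Fin n)) (S : Finset (Fin n)) (θ ω : ℝ)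
    (a : Fin n) : ∑ b, objMatrix W S θ ω a b = (1 - θ) * (1 - ω * indVec S a) := by
  simp_rw [objMatrix_apply, ← Finset.mul_sum, sum_row, mul_one]

lemma isTransient_objMatrix_of_stub (W : Matrix.rowStochastic ℝ (Fin n)) (S : Finset (Fin n))
    {θ ω : ℝ} (hθ : 0 < θ) (hθ1 : θ ≤ 1) (hω : 0 ≤ ω) (hω1 : ω ≤ 1) :
    IsTransient (objMatrix W S θ ω) := by
  have hS : ∀ a, 0 ≤ 1 - ω * indVec S a := fun a =>
    sub_nonneg.2 (mul_le_one₀ hω1 (indVec_mem S a).1 (indVec_mem S a).2)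
  have hlt : ∀ a, ∑ b, objMatrix W S θ ω a b < 1 := by
    intro a
    rw [sum_objMatrix]
    have := mul_nonneg hω (indVec_mem S a).1
    nlinarith [hS a]
  refine ⟨fun a b => ?_, fun a => (hlt a).le, fun a => ⟨a, .refl, hlt a⟩⟩
  rw [objMatrix_apply]
  exact mul_nonneg (sub_nonneg.2 hθ1) (mul_nonneg (hS a) (W.2.1 a b))

/-- Since `ω < 1`, every edge of `W` survives, so `i` is still reachable; its row sums to `1 - ω`.
-/
lemma isTransient_objMatrix_of_link (W : Matrix.rowStochastic ℝ (Fin n))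
    (hconn : StronglyConnected W) (i : Fin n) {ω : ℝ} (hω : 0 < ω) (hω1 : ω < 1) :
    IsTransient (objMatrix W {i} 0 ω) := by
  have hS : ∀ a, 0 < 1 - ω * indVec {i} a := by
    intro a
    unfold indVec
    split_ifs <;> linarith
  refine ⟨fun a b => ?_, fun a => ?_, fun a => ⟨i, ?_, ?_⟩⟩
  · rw [objMatrix_apply, sub_zero, one_mul]
    exact mul_nonneg (hS a).le (W.2.1 a b)
  · rw [sum_objMatrix]
    have := mul_nonneg hω.le (indVec_mem {i} a).1
    linarith
  · refine Relation.ReflTransGen.mono (fun k l hkl => ?_) _ _ (exists_path W hconn a i)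
    rw [objMatrix_apply, sub_zero, one_mul]
    exact mul_pos (hS k) hkl
  · rw [sum_objMatrix]
    simp [indVec, hω]

/-- Mean hitting times of `i`, as the solution of the first-step equations. -/
def meanHit (W : Matrix.rowStochastic ℝ (Fin n)) (i : Fin n) : Fin n → ℝ :=
  ((1 - tabooMatrix W i)⁻¹).mulVec 1

lemma tabooMatrix_mulVec (W : Matrix.rowStochastic ℝ (Fin n)) (i a : Fin n) (x : Fin n → ℝ) :
    (tabooMatrix W i).mulVec x a = W.1.mulVec x a - W.1 a i * x i := by
  have h : ∀ b, tabooMatrix W i a b * x b =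
      W.1 a b * x b - if b = i then W.1 a b * x b else 0 := by
    intro b
    unfold tabooMatrix
    split_ifs <;> simp
  simp only [Matrix.mulVec, dotProduct, h]
  rw [Finset.sum_sub_distrib]
  simp

lemma meanHit_eq (W : Matrix.rowStochastic ℝ (Fin n)) (hconn : StronglyConnected W)
    (i a : Fin n) :
    meanHit W i a = 1 + (W.1.mulVec (meanHit W i) a - W.1 a i * meanHit W i i) := by
  have := congrFun ((isTransient_tabooMatrix W hconn i).inv_mulVec_eq 1) a
  rw [Pi.add_apply, tabooMatrix_mulVec] at this
  exact this

lemma objMatrix_mulVec (W : Matrix.rowStochastic ℝ (Fin n)) (S : Finset (Fin n)) (θ ω : ℝ)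
    (x : Fin n → ℝ) (a : Fin n) :
    (objMatrix W S θ ω).mulVec x a = (1 - θ) * ((1 - ω * indVec S a) * W.1.mulVec x a) := by
  simp only [Matrix.mulVec, dotProduct, objMatrix_apply, Finset.mul_sum]
  exact Finset.sum_congr rfl fun b _ => by ring

lemma objF_zero_eq (W : Matrix.rowStochastic ℝ (Fin n)) (hconn : StronglyConnected W)
    (i : Fin n) {ω : ℝ} (hω : 0 < ω) (hω1 : ω < 1) :
    objF W {i} 0 ω = 1 + ((n : ℝ)⁻¹ * ∑ j ∈ Finset.univ.erase i, meanHit W i j +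
      (1 - ω) / ω * meanHit W i i) := by
  set h := meanHit W i with hh
  -- `c` is the mean absorption time from `i`: the final step plus `(1 - ω)/ω` expected returns.
  -- From another agent, the mean time to reach `i` is added.
  set c : ℝ := 1 + (1 - ω) / ω * h i with hc
  set x : Fin n → ℝ := fun a => (if a = i then 0 else h a) + c with hx
  have hWx : ∀ a, W.1.mulVec x a = h a - 1 + c := by
    intro a
    have h1 : ∀ b, W.1 a b * x b =
        W.1 a b * h b - (if b = i then W.1 a b * h b else 0) + W.1 a b * c := by
      intro b
      simp only [hx]
      split_ifs <;> ring
    have h2 : W.1.mulVec x a = W.1.mulVec h a - W.1 a i * h i + c := by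
      simp only [Matrix.mulVec, dotProduct, h1]
      rw [Finset.sum_add_distrib, Finset.sum_sub_distrib, ← Finset.sum_mul, sum_row]
      simp
    have h3 := meanHit_eq W hconn i a
    rw [← hh] at h3
    rw [h2]
    linarith
  have hsol : x = ((1 - objMatrix W {i} 0 ω)⁻¹).mulVec 1 := by
    refine (isTransient_objMatrix_of_link W hconn i hω hω1).eq_inv_mulVec (funext fun a => ?_)
    rw [Pi.add_apply, objMatrix_mulVec, hWx, Pi.one_apply]
    by_cases ha : a = i
    · subst ha
      simp only [hx, if_true, hc, indVec, Finset.mem_singleton]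
      field_simp
      ring
    · simp only [hx, if_neg ha, indVec, Finset.mem_singleton]
      ring
  have hn : (n : ℝ) ≠ 0 := by
    have : 0 < n := i.pos
    positivity
  change 1 / (n : ℝ) * ((1 : Fin n → ℝ) ⬝ᵥ ((1 - objMatrix W {i} 0 ω)⁻¹).mulVec 1) = _
  rw [← hsol, one_dotProduct]
  have hsum : ∑ a, x a = ∑ j ∈ Finset.univ.erase i, h j + n * c := by
    simp only [hx]
    rw [Finset.sum_add_distrib, ← Finset.add_sum_erase _ _ (Finset.mem_univ i), if_pos rfl, zero_add,
      Finset.sum_congr rfl fun j hj => if_neg (Finset.ne_of_mem_erase hj)]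
    simp
  rw [hsum, hc]
  field_simp
  ring

end Model

/-! ### Neumann series applied to the all-ones vector. -/

section Neumann

variable {α : Type*} [Fintype α] [DecidableEq α] {A : Matrix α α ℝ}

lemma pow_succ_mulVec_apply (A : Matrix α α ℝ) (t : ℕ) (x : α → ℝ) (i : α) :
    (A ^ (t + 1)).mulVec x i = ∑ k, A i k * (A ^ t).mulVec x k := by
  rw [pow_succ', ← Matrix.mulVec_mulVec]
  rfl

namespace IsTransient

lemma pow_mulVec_nonneg (hA : IsTransient A) {x : α → ℝ} (hx : ∀ i, 0 ≤ x i) (t : ℕ) (i : α) :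
    0 ≤ (A ^ t).mulVec x i := by
  induction t generalizing i with
  | zero => simpa using hx i
  | succ t ih =>
    rw [pow_succ_mulVec_apply]
    exact Finset.sum_nonneg fun k _ => mul_nonneg (hA.nonneg i k) (ih k)

/-- Iterating `u = 1 + A u` for `u = (1 - A)⁻¹ 1`. The remainder is nonnegative, so `u` bounds the
partial sums and no spectral radius is needed. -/
lemma sum_range_pow_mulVec_one (hA : IsTransient A) (m : ℕ) (i : α) :
    ∑ t ∈ Finset.range m, (A ^ t).mulVec 1 i + (A ^ m).mulVec (((1 - A)⁻¹).mulVec 1) i =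
      ((1 - A)⁻¹).mulVec 1 i := by
  induction m with
  | zero => simp
  | succ m ih =>
    have h : (A ^ m).mulVec (((1 - A)⁻¹).mulVec 1) i =
        (A ^ m).mulVec 1 i + (A ^ (m + 1)).mulVec (((1 - A)⁻¹).mulVec 1) i := by
      rw [pow_succ, ← Matrix.mulVec_mulVec, ← Pi.add_apply, ← Matrix.mulVec_add,
        ← hA.inv_mulVec_eq]
    rw [Finset.sum_range_succ, ← ih, h]
    ring

lemma summable_pow_mulVec_one (hA : IsTransient A) (i : α) :
    Summable fun t => (A ^ t).mulVec 1 i := by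
  refine summable_of_sum_range_le (c := ((1 - A)⁻¹).mulVec 1 i)
    (fun t => hA.pow_mulVec_nonneg (fun _ => zero_le_one) t i) fun m => ?_
  have := hA.sum_range_pow_mulVec_one m i
  have := hA.pow_mulVec_nonneg hA.inv_mulVec_one_nonneg m i
  linarith

lemma tsum_pow_mulVec_one (hA : IsTransient A) (i : α) :
    ∑' t, (A ^ t).mulVec 1 i = ((1 - A)⁻¹).mulVec 1 i := by
  -- The series solves the first-step equation, whose solution is unique.
  have h : (fun j => ∑' t, (A ^ t).mulVec 1 j) = ((1 - A)⁻¹).mulVec 1 := by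
    refine hA.eq_inv_mulVec (funext fun j => ?_)
    rw [(hA.summable_pow_mulVec_one j).tsum_eq_zero_add, Pi.add_apply]
    simp_rw [pow_succ_mulVec_apply]
    rw [Summable.tsum_finsetSum fun k _ => (hA.summable_pow_mulVec_one k).mul_left _]
    simp_rw [tsum_mul_left]
    rw [pow_zero, Matrix.one_mulVec]
    rfl
  exact congrFun h i

end IsTransient

end Neumann

/-! ### Expected hitting times as mean hitting vectors. -/

section Model

variable {n : ℕ}

/-- With zero stubbornness the primed states are never entered from an agent, and the avoided state
amounts to a zeroed column. -/
lemma avoidProb_aug (W : Matrix.rowStochastic ℝ (Fin n)) (hconn : StronglyConnected W)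
    (i j : Fin n) (t : ℕ) :
    avoidProb (augTransition W fun _ => 0) (Sum.inl i) t (Sum.inl j) =
      ENNReal.ofReal (((tabooMatrix W i) ^ t).mulVec 1 j) := by
  have hT := isTransient_tabooMatrix W hconn i
  induction t generalizing j with
  | zero => simp [avoidProb_zero]
  | succ t ih =>
    have hnn := hT.pow_mulVec_nonneg (x := 1) (fun _ => zero_le_one) t
    rw [avoidProb_succ, Fintype.sum_sum_type, pow_succ_mulVec_apply,
      ENNReal.ofReal_sum_of_nonneg fun k _ => mul_nonneg (hT.nonneg j k) (hnn k)]
    have hr : ∀ k : Fin n, (augTransition W fun _ => 0).1 (Sum.inl j) (Sum.inr k) = 0 := by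
      intro k
      simp [augTransition, augMatrix, stubMatrix]
    have hl : ∀ k : Fin n, (augTransition W fun _ => 0).1 (Sum.inl j) (Sum.inl k) = W.1 j k := by
      intro k
      simp [augTransition, augMatrix, stubMatrix]
    simp only [hr, hl, ENNReal.ofReal_zero, zero_mul, Finset.sum_const_zero, add_zero, ih]
    refine Finset.sum_congr rfl fun k _ => ?_
    rw [ENNReal.ofReal_mul (hT.nonneg j k)]
    by_cases hk : k = i
    · simp [hk, avoidInd, tabooMatrix]
    · simp [hk, avoidInd, tabooMatrix]

lemma meanHit_nonneg (W : Matrix.rowStochastic ℝ (Fin n)) (hconn : StronglyConnected W)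
    (i j : Fin n) : 0 ≤ meanHit W i j :=
  (isTransient_tabooMatrix W hconn i).inv_mulVec_one_nonneg j

lemma expHitTime_eq (W : Matrix.rowStochastic ℝ (Fin n)) (hconn : StronglyConnected W)
    (j i : Fin n) : expHitTime W j i = ENNReal.ofReal (meanHit W i j) := by
  have hT := isTransient_tabooMatrix W hconn i
  rw [expHitTime, lintegral_hitTime]
  simp_rw [avoidProb_aug W hconn]
  rw [← ENNReal.ofReal_tsum_of_nonneg
    (fun t => hT.pow_mulVec_nonneg (x := 1) (fun _ => zero_le_one) t j) (hT.summable_pow_mulVec_one j),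
    hT.tsum_pow_mulVec_one]
  rfl

lemma hitCost_eq (W : Matrix.rowStochastic ℝ (Fin n)) (hconn : StronglyConnected W)
    {ω : ℝ} (hω : 0 < ω) (hω1 : ω < 1) (i : Fin n) :
    1 ≤ objF W {i} 0 ω ∧ hitCost W ω i = ENNReal.ofReal (objF W {i} 0 ω - 1) := by
  have hn : 0 < (n : ℝ) := Nat.cast_pos.2 i.pos
  have h0 : 0 ≤ (1 - ω) / ω := div_nonneg (by linarith) hω.le
  have h1 := mul_nonneg h0 (meanHit_nonneg W hconn i i)
  have h2 : 0 ≤ ∑ j ∈ Finset.univ.erase i, meanHit W i j :=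
    Finset.sum_nonneg fun j _ => meanHit_nonneg W hconn i j
  have h3 := mul_nonneg (inv_nonneg.2 hn.le) h2
  rw [objF_zero_eq W hconn i hω hω1]
  refine ⟨by linarith, ?_⟩
  rw [add_sub_cancel_left, ENNReal.ofReal_add h3 h1, ENNReal.ofReal_mul (inv_nonneg.2 hn.le),
    ENNReal.ofReal_mul h0, ENNReal.ofReal_sum_of_nonneg fun j _ => meanHit_nonneg W hconn i j,
    ENNReal.ofReal_inv_of_pos hn, ENNReal.ofReal_natCast, hitCost]
  simp_rw [expHitTime_eq W hconn]

/-- The bound `1 ≤ objF` keeps `ENNReal.ofReal` from truncating, so the order is preserved. -/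
lemma hitCost_le_iff (W : Matrix.rowStochastic ℝ (Fin n)) (hconn : StronglyConnected W)
    {ω : ℝ} (hω : 0 < ω) (hω1 : ω < 1) (i k : Fin n) :
    hitCost W ω i ≤ hitCost W ω k ↔ objF W {i} 0 ω ≤ objF W {k} 0 ω := by
  obtain ⟨-, h1⟩ := hitCost_eq W hconn hω hω1 i
  obtain ⟨hk, h2⟩ := hitCost_eq W hconn hω hω1 k
  rw [h1, h2, ENNReal.ofReal_le_ofReal_iff (sub_nonneg.2 hk)]
  exact sub_le_sub_iff_right 1

/-! ### Absorption at the influencer under positive stubbornness. -/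

/-- The probability that the influenced chain has not visited the influencer up to time `t`, as a function
of the initial agent. -/
def survival (W : Matrix.rowStochastic ℝ (Fin n)) (S : Finset (Fin n)) (θ ω : ℝ) :
    ℕ → Fin n → ℝ
  | 0 => 1
  | t + 1 => fun j => θ + ∑ k, objMatrix W S θ ω j k * survival W S θ ω t k

lemma survival_nonneg (W : Matrix.rowStochastic ℝ (Fin n)) (S : Finset (Fin n)) {θ ω : ℝ}
    (hA : IsTransient (objMatrix W S θ ω)) (hθ : 0 ≤ θ) (t : ℕ) (j : Fin n) :
    0 ≤ survival W S θ ω t j := by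
  induction t generalizing j with
  | zero => exact zero_le_one
  | succ t ih =>
    exact add_nonneg hθ (Finset.sum_nonneg fun k _ => mul_nonneg (hA.nonneg j k) (ih k))

/-- Primed states are absorbing and survive with probability one, which yields the constant term `θ`
in the recursion. -/
lemma avoidProb_infl (W : Matrix.rowStochastic ℝ (Fin n)) (S : Finset (Fin n)) (θ ω : I)
    (hA : IsTransient (objMatrix W S θ ω)) (t : ℕ) :
    (∀ j, avoidProb (inflTransition W (fun _ => θ) ω S) (Sum.inl ()) t (Sum.inr (Sum.inl j)) =
      ENNReal.ofReal (survival W S θ ω t j)) ∧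
    ∀ j, avoidProb (inflTransition W (fun _ => θ) ω S) (Sum.inl ()) t (Sum.inr (Sum.inr j)) =
      1 := by
  induction t with
  | zero => simp [avoidProb_zero, survival]
  | succ t ih =>
    obtain ⟨ih1, ih2⟩ := ih
    have hnn := survival_nonneg W S hA θ.2.1
    refine ⟨fun j => ?_, fun j => ?_⟩
    · have h1 : ∀ k : Fin n, (inflTransition W (fun _ => θ) ω S).1 (Sum.inr (Sum.inl j))
          (Sum.inr (Sum.inl k)) = objMatrix W S θ ω j k := by
        intro k
        simp only [inflTransition, inflMatrix, Matrix.fromBlocks_apply₂₂,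
          Matrix.fromBlocks_apply₁₁, HMatrix_apply, objMatrix_apply]
        ring
      have h2 : ∀ k : Fin n, (inflTransition W (fun _ => θ) ω S).1 (Sum.inr (Sum.inl j))
          (Sum.inr (Sum.inr k)) = if j = k then (θ : ℝ) else 0 := by
        intro k
        simp [inflTransition, inflMatrix, stubMatrix, Matrix.diagonal_apply]
      rw [avoidProb_succ, Fintype.sum_sum_type, Fintype.sum_sum_type]
      simp only [h1, h2, ih1, ih2, avoidInd, survival]
      rw [ENNReal.ofReal_add θ.2.1
        (Finset.sum_nonneg fun k _ => mul_nonneg (hA.nonneg j k) (hnn t k)),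
        ENNReal.ofReal_sum_of_nonneg fun k _ => mul_nonneg (hA.nonneg j k) (hnn t k)]
      simp only [ENNReal.ofReal_mul (hA.nonneg j _), apply_ite ENNReal.ofReal]
      simp [add_comm]
    · have h1 : ∀ k : Fin n, (inflTransition W (fun _ => θ) ω S).1 (Sum.inr (Sum.inr j))
          (Sum.inr (Sum.inl k)) = 0 := by
        intro k
        simp [inflTransition, inflMatrix]
      have h2 : ∀ k : Fin n, (inflTransition W (fun _ => θ) ω S).1 (Sum.inr (Sum.inr j))
          (Sum.inr (Sum.inr k)) = if j = k then 1 else 0 := by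
        intro k
        simp [inflTransition, inflMatrix, Matrix.one_apply]
      rw [avoidProb_succ, Fintype.sum_sum_type, Fintype.sum_sum_type]
      simp only [h1, h2, ih2, avoidInd, apply_ite ENNReal.ofReal]
      simp

instance instIsProbabilityMeasureInitLaw (n : ℕ) : IsProbabilityMeasure (initLaw n) where
  measure_univ := by
    simp only [initLaw, Measure.smul_apply, Measure.add_apply, Measure.finsetSum_apply,
      measure_univ, Finset.sum_const, Finset.card_univ, Fintype.card_fin, nsmul_eq_mul, mul_one,
      smul_eq_mul]
    rw [add_comm 1]
    exact ENNReal.inv_mul_cancel (by simp) (by finiteness)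

lemma lintegral_initLaw_avoid (W : Matrix.rowStochastic ℝ (Fin n)) (S : Finset (Fin n)) (θ ω : I)
    (hA : IsTransient (objMatrix W S θ ω)) (t : ℕ) :
    ∫⁻ a, avoidInd (Sum.inl ()) a *
        avoidProb (inflTransition W (fun _ => θ) ω S) (Sum.inl ()) t a ∂(initLaw n) =
      ENNReal.ofReal (((n : ℝ) + 1)⁻¹ * ∑ j, survival W S θ ω t j) := by
  have hnn := survival_nonneg W S hA θ.2.1 t
  rw [initLaw, lintegral_smul_measure, lintegral_add_measure, lintegral_finsetSum_measure]
  simp only [lintegral_dirac, (avoidProb_infl W S θ ω hA t).1]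
  rw [ENNReal.ofReal_mul (by positivity), ENNReal.ofReal_sum_of_nonneg fun j _ => hnn j,
    ENNReal.ofReal_inv_of_pos (by positivity), ENNReal.ofReal_add (by positivity) zero_le_one]
  simp [avoidInd]

lemma tendsto_survival (W : Matrix.rowStochastic ℝ (Fin n)) (S : Finset (Fin n)) {θ ω : ℝ}
    (hA : IsTransient (objMatrix W S θ ω)) (hθ : 0 < θ) (hθ1 : θ ≤ 1) (hω : 0 ≤ ω)
    (j : Fin n) :
    Filter.Tendsto (fun t => survival W S θ ω t j) Filter.atTop
      (nhds (θ * ((1 - objMatrix W S θ ω)⁻¹).mulVec 1 j)) := by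
  set v := ((1 - objMatrix W S θ ω)⁻¹).mulVec 1 with hv
  have hveq : ∀ j, v j = 1 + ∑ k, objMatrix W S θ ω j k * v k := fun j =>
    congrFun (hA.inv_mulVec_eq 1) j
  set C : ℝ := ∑ k, |1 - θ * v k| with hC
  have hC0 : 0 ≤ C := Finset.sum_nonneg fun k _ => abs_nonneg _
  have hrow : ∀ j, ∑ k, objMatrix W S θ ω j k ≤ 1 - θ := by
    intro j
    rw [sum_objMatrix]
    have := mul_nonneg hω (indVec_mem S j).1
    nlinarith
  -- Row sums are at most `1 - θ`, so the distance to the fixed point `θ v` contracts by that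
  -- factor; `C` dominates the initial error.
  have hbound : ∀ t j, |survival W S θ ω t j - θ * v j| ≤ (1 - θ) ^ t * C := by
    intro t
    induction t with
    | zero =>
      intro j
      rw [pow_zero, one_mul]
      exact Finset.single_le_sum (f := fun k => |1 - θ * v k|) (fun k _ => abs_nonneg _)
        (Finset.mem_univ j)
    | succ t ih =>
      intro j
      have h1 : survival W S θ ω (t + 1) j - θ * v j =
          ∑ k, objMatrix W S θ ω j k * (survival W S θ ω t k - θ * v k) := by
        rw [hveq j, survival, mul_add, Finset.mul_sum]
        simp_rw [mul_sub]
        rw [Finset.sum_sub_distrib, Finset.sum_congr rfl fun k _ =>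
          mul_left_comm θ (objMatrix W S θ ω j k) (v k)]
        ring
      rw [h1]
      calc _ ≤ ∑ k, |objMatrix W S θ ω j k * (survival W S θ ω t k - θ * v k)| :=
            Finset.abs_sum_le_sum_abs _ _
        _ ≤ ∑ k, objMatrix W S θ ω j k * ((1 - θ) ^ t * C) := by
            refine Finset.sum_le_sum fun k _ => ?_
            rw [abs_mul, abs_of_nonneg (hA.nonneg j k)]
            exact mul_le_mul_of_nonneg_left (ih k) (hA.nonneg j k)
        _ = (∑ k, objMatrix W S θ ω j k) * ((1 - θ) ^ t * C) := by rw [Finset.sum_mul]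
        _ ≤ (1 - θ) * ((1 - θ) ^ t * C) :=
            mul_le_mul_of_nonneg_right (hrow j)
              (mul_nonneg (pow_nonneg (sub_nonneg.2 hθ1) t) hC0)
        _ = (1 - θ) ^ (t + 1) * C := by ring
  have hlim : Filter.Tendsto (fun t => (1 - θ) ^ t * C) Filter.atTop (nhds 0) := by
    simpa using (tendsto_pow_atTop_nhds_zero_of_lt_one (sub_nonneg.2 hθ1)
      (by linarith : 1 - θ < 1)).mul_const C
  rw [tendsto_iff_dist_tendsto_zero]
  exact squeeze_zero (fun _ => dist_nonneg) (fun t => hbound t j) hlim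

lemma one_sub_absorbProb (W : Matrix.rowStochastic ℝ (Fin n)) (S : Finset (Fin n)) {θ ω : I}
    (hθ : 0 < θ) :
    1 - absorbProb W (fun _ => θ) ω S =
      ENNReal.ofReal (((n : ℝ) + 1)⁻¹ * (θ * (n * objF W S θ ω))) := by
  have hA := isTransient_objMatrix_of_stub W S (θ := θ) (ω := ω) hθ θ.2.2 ω.2.1 ω.2.2
  have h1 := tendsto_chainLaw_avoid (inflTransition W (fun _ => θ) ω S) (initLaw n) (Sum.inl ())
  simp_rw [lintegral_initLaw_avoid W S θ ω hA] at h1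
  have h2 := (tendsto_finsetSum Finset.univ fun j _ =>
    tendsto_survival W S hA hθ θ.2.2 ω.2.1 j).const_mul (((n : ℝ) + 1)⁻¹)
  rw [absorbProb, tendsto_nhds_unique h1 (ENNReal.tendsto_ofReal h2)]
  congr 2
  rw [← Finset.mul_sum]
  congr 1
  change _ = (n : ℝ) * (1 / (n : ℝ) *
    ((1 : Fin n → ℝ) ⬝ᵥ ((1 - objMatrix W S θ ω)⁻¹).mulVec 1))
  rw [one_dotProduct]
  rcases Nat.eq_zero_or_pos n with rfl | hn
  · simp
  · have : (n : ℝ) ≠ 0 := by positivity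
    field_simp

lemma objF_nonneg (W : Matrix.rowStochastic ℝ (Fin n)) (S : Finset (Fin n)) {θ ω : ℝ}
    (hA : IsTransient (objMatrix W S θ ω)) : 0 ≤ objF W S θ ω := by
  change 0 ≤ 1 / (n : ℝ) * ((1 : Fin n → ℝ) ⬝ᵥ ((1 - objMatrix W S θ ω)⁻¹).mulVec 1)
  rw [one_dotProduct]
  exact mul_nonneg (by positivity) (Finset.sum_nonneg fun j _ => hA.inv_mulVec_one_nonneg j)

lemma absorbProb_le_iff (W : Matrix.rowStochastic ℝ (Fin n)) (S S' : Finset (Fin n)) {θ ω : I}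
    (hθ : 0 < θ) (hn : 0 < n) :
    absorbProb W (fun _ => θ) ω S' ≤ absorbProb W (fun _ => θ) ω S ↔
      objF W S θ ω ≤ objF W S' θ ω := by
  have hA := isTransient_objMatrix_of_stub W S' (θ := θ) (ω := ω) hθ θ.2.2 ω.2.1 ω.2.2
  have hθ' : (0 : ℝ) < θ := hθ
  have hn' : (0 : ℝ) < n := Nat.cast_pos.2 hn
  have h0 := objF_nonneg W S' hA
  have hle : absorbProb W (fun _ => θ) ω S' ≤ 1 := prob_le_one
  rw [← ENNReal.sub_le_sub_iff_left hle ENNReal.one_ne_top,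
    one_sub_absorbProb W S hθ, one_sub_absorbProb W S' hθ,
    ENNReal.ofReal_le_ofReal_iff (by positivity), mul_le_mul_iff_right₀ (by positivity),
    mul_le_mul_iff_right₀ hθ', mul_le_mul_iff_right₀ hn']

/-- Without links the solution is the constant `θ⁻¹`. Its excess `w` over the solution for `{i}`
solves `w = A w + r` with `r ≥ 0` and `r i > 0`, so `w ≥ 0` and `w i > 0`. -/
lemma objF_singleton_lt_empty (W : Matrix.rowStochastic ℝ (Fin n)) (i : Fin n) {θ ω : ℝ}
    (hθ : 0 < θ) (hθ1 : θ < 1) (hω : 0 < ω) (hω1 : ω ≤ 1) :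
    objF W {i} θ ω < objF W ∅ θ ω := by
  have hA := isTransient_objMatrix_of_stub W {i} hθ hθ1.le hω.le hω1
  have hE := isTransient_objMatrix_of_stub W ∅ hθ hθ1.le hω.le hω1
  have hconst : ∀ (S : Finset (Fin n)) a,
      (objMatrix W S θ ω).mulVec (fun _ => θ⁻¹) a = (1 - θ) * (1 - ω * indVec S a) * θ⁻¹ := by
    intro S a
    rw [← sum_objMatrix W, Finset.sum_mul]
    rfl
  have hempty : (fun _ => θ⁻¹) = ((1 - objMatrix W ∅ θ ω)⁻¹).mulVec 1 := by
    refine hE.eq_inv_mulVec (funext fun a => ?_)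
    rw [Pi.add_apply, hconst, Pi.one_apply]
    simp only [indVec, Finset.notMem_empty, if_false]
    field_simp
    ring
  set v := ((1 - objMatrix W {i} θ ω)⁻¹).mulVec 1 with hv
  set w : Fin n → ℝ := (fun _ => θ⁻¹) - v with hw
  have hweq : ∀ a, w a = (objMatrix W {i} θ ω).mulVec w a +
      (1 - θ) * (ω * indVec {i} a) * θ⁻¹ := by
    intro a
    have h1 := congrFun (hA.inv_mulVec_eq 1) a
    rw [← hv, Pi.add_apply, Pi.one_apply] at h1
    rw [hw, Matrix.mulVec_sub, Pi.sub_apply, Pi.sub_apply, hconst, h1]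
    field_simp
    ring
  have hr : ∀ a, 0 ≤ (1 - θ) * (ω * indVec {i} a) * θ⁻¹ := fun a =>
    mul_nonneg (mul_nonneg (sub_nonneg.2 hθ1.le) (mul_nonneg hω.le (indVec_mem {i} a).1))
      (inv_nonneg.2 hθ.le)
  have hwnn : ∀ a, 0 ≤ w a :=
    hA.nonneg_of_mulVec_le fun a => by linarith [hweq a, hr a]
  have hwi : 0 < w i := by
    rw [hweq i]
    have hs : 0 ≤ (objMatrix W {i} θ ω).mulVec w i := by
      simpa only [pow_one] using hA.pow_mulVec_nonneg hwnn 1 i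
    refine add_pos_of_nonneg_of_pos hs ?_
    simp only [indVec, Finset.mem_singleton, if_true, mul_one]
    exact mul_pos (mul_pos (sub_pos.2 hθ1) hω) (inv_pos.2 hθ)
  change 1 / (n : ℝ) * ((1 : Fin n → ℝ) ⬝ᵥ ((1 - objMatrix W {i} θ ω)⁻¹).mulVec 1) <
    1 / (n : ℝ) * ((1 : Fin n → ℝ) ⬝ᵥ ((1 - objMatrix W ∅ θ ω)⁻¹).mulVec 1)
  rw [← hv, ← hempty, one_dotProduct, one_dotProduct]
  have hn : (0 : ℝ) < n := Nat.cast_pos.2 i.pos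
  refine mul_lt_mul_of_pos_left (Finset.sum_lt_sum (fun k _ => ?_) ⟨i, Finset.mem_univ i, ?_⟩)
    (by positivity)
  · exact sub_nonneg.1 (hwnn k)
  · exact sub_pos.1 hwi

end Model

end SocialPower

end

open SocialPower in
/-- Homogeneous stubbornness `θ` and budget `K = 1`: maximizing the absorption probability `π₀(S)`
over `|S| ≤ 1` is equivalent to minimizing the hitting-time cost over single agents. -/
theorem proposition3 {n : ℕ} (W : Matrix.rowStochastic ℝ (Fin n)) (θ ω : unitInterval)
    (hθ : 0 < θ ∧ θ < 1) (hω : 0 < ω ∧ ω < 1)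
    (hconn : StronglyConnected W)
    (hsmall : SmallStubbornness W θ ω) :
    (∀ j i : Fin n, expHitTime W j i < ⊤) ∧
      ∀ S : Finset (Fin n),
        IsOptimalSet W (fun _ => θ) ω 1 S ↔
          ∃ i : Fin n, S = {i} ∧ ∀ k : Fin n, hitCost W ω i ≤ hitCost W ω k := by
  have hω0 : (0 : ℝ) < ω := hω.1
  have hω1 : (ω : ℝ) < 1 := hω.2
  refine ⟨fun j i => ?_, fun S => ?_⟩
  · rw [expHitTime_eq W hconn]
    exact ENNReal.ofReal_lt_top
  obtain ⟨i₀, hmin, hstub⟩ := hsmall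
  have hlt : ∀ S : Finset (Fin n), S.card ≤ 1 → S ≠ {i₀} → objF W {i₀} θ ω < objF W S θ ω := by
    intro S hS hne
    rcases Nat.le_one_iff_eq_zero_or_eq_one.1 hS with h | h
    · rw [Finset.card_eq_zero.1 h]
      exact objF_singleton_lt_empty W i₀ hθ.1 hθ.2 hω0 hω1.le
    · obtain ⟨i, rfl⟩ := Finset.card_eq_one.1 h
      exact sub_pos.1 (hstub i fun hi => hne (by rw [hi]))
  -- Strictness in `hlt` makes `{i₀}` the only optimal set, not merely one of them.
  have hopt : IsOptimalSet W (fun _ => θ) ω 1 S ↔ S = {i₀} := by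
    constructor
    · rintro ⟨hS, hbest⟩
      by_contra hne
      have := (absorbProb_le_iff W S {i₀} hθ.1 i₀.pos).1 (hbest {i₀} (by simp))
      exact absurd (hlt S hS hne) this.not_gt
    · rintro rfl
      refine ⟨by simp, fun S' hS' => ?_⟩
      rw [absorbProb_le_iff W _ _ hθ.1 i₀.pos]
      by_cases h : S' = {i₀}
      · rw [h]
      · exact (hlt S' hS' h).le
  rw [hopt]
  constructor
  · rintro rfl
    refine ⟨i₀, rfl, fun k => ?_⟩
    rw [hitCost_le_iff W hconn hω0 hω1]
    by_cases h : k = i₀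
    · rw [h]
    · exact (hmin k h).le
  · rintro ⟨i, rfl, hi⟩
    by_contra hne
    have hne' : i ≠ i₀ := fun h => hne (by rw [h])
    exact absurd (hmin i hne') ((hitCost_le_iff W hconn hω0 hω1 i i₀).1 (hi i₀)).not_gt
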